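/- Let $\epsilon\in\{1,-1\}$ and let $\star$ be either the transpose ($\mu^\star=\mu$ for scalars) or the conjugate transpose ($\mu^\star=\bar\mu$) of complex matrices. A regular $\star$-(anti)-palindromic system of order $m$ is a matrix polynomial $Q(\lambda)=\lambda^2A_1^\star+\lambda A_0+\epsilon A_1$ with $A_1,A_0\in\mathbb{C}^{m\times m}$, $A_0^\star=\epsilon A_0$ and $A_1$ nonsingular. For $X\in\mathbb{C}^{n\times k}$ and $T\in\mathbb{C}^{k\times k}$ put $$\mathbb{S}_{(X,T)}=\{S\in\mathbb{C}^{k\times k} : S^\star=-\epsilon S,\ S=TST^\star,\ XSX^\star=0\}.$$ A square matrix $J$ is in palindromic Jordan canonical form if $J=\mathrm{diag}(J_1,\dots,J_t)$, where $J_i=\lambda_iI+\mathrm{diag}(N_{i1},\dots,N_{im_i})$, $m_i\ge 1$, $N_{ij}$ is the nilpotent matrix of order $n_{ij}\ge1$ with ones on the superdiagonal and zeros elsewhere, $n_{i1}\ge\dots\ge n_{im_i}$, the numbers $\lambda_1,\dots,\lambda_t$ are distinct and nonzero, and for some $\ell$ with $2\ell\le t$: for $i\le\ell$, $\lambda_{2i}=1/\lambda_{2i-1}^\star$,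 $|\lambda_{2i-1}|\le1$ and $\lambda_{2i-1},\lambda_{2i}$ have the same partial multiplicities ($m_{2i-1}=m_{2i}$ and $n_{2i-1,j}=n_{2i,j}$); for $i>2\ell$, $\lambda_i\lambda_i^\star=1$ (that is, $\lambda_i=\pm1$ if $\star$ is the transpose, $|\lambda_i|=1$ if $\star$ is the conjugate transpose). Let $X\in\mathbb{C}^{n\times 2n}$ and let $J\in\mathbb{C}^{2n\times 2n}$ be in palindromic Jordan canonical form, such that the $2n\times 2n$ matrix $\begin{bmatrix}X\\-XJ^{-1}\end{bmatrix}$ is nonsingular and every eigenvalue of $J$ has geometric multiplicity one. Let $S,\widetilde S\in\mathbb{S}_{(X,J)}$ be nonsingular and let $\zeta_n(\widetilde SS^{-1})=(n_1,\dots,n_{\hat t})$. Here $\zeta_n(\widetilde SS^{-1})$ has one entry for each distinct class $\{\mu,\mu^\star\}$ of eigenvalues of $\widetilde SS^{-1}$, in any order, and this entry is half the total algebraic multiplicity of the class (so it is $k$ if $\mu\neq\mu^\star$ both have multiplicity $k$, and also if $\mu=\mu^\star$ has multiplicity $2k$). Then $n_1+\dots+n_{\hat t}=n$, and there is a nonsingular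 $K\in\mathbb{C}^{n\times n}$ such that for every nonsingular $\widehat S\in\mathbb{S}_{(X,J)}$ the matrices $$\widehat A_1=\epsilon\,(XJ^{-1}\widehat SX^\star)^{-1},\qquad \widehat A_0=-\widehat A_1XJ^{-2}\widehat SX^\star\widehat A_1$$ define a regular $\star$-(anti)-palindromic system $\widehat Q(\lambda)=\lambda^2\widehat A_1^\star+\lambda\widehat A_0+\epsilon\widehat A_1$, and $$K^\star\widehat Q(\lambda)K=\mathrm{diag}(Q_1(\lambda),\dots,Q_{\hat t}(\lambda))\quad\text{for all }\lambda\in\mathbb{C},$$ where $Q_i(\lambda)$ is a regular $\star$-(anti)-palindromic system of order $n_i$ for $i=1,\dots,\hat t$. The matrix $K$ does not depend on $\widehat S$. -/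

import Mathlib

namespace Palindromic

/-- The two meanings of the symbol `⋆` on complex matrices: transpose or conjugate transpose. -/
inductive StarKind where
  | transpose
  | conjTranspose

/-- `μ ↦ μ^⋆` on scalars: the identity, or complex conjugation. -/
noncomputable def StarKind.scalar : StarKind → ℂ → ℂ
  | .transpose, z => z
  | .conjTranspose, z => star z

/-- `A ↦ A^⋆` on matrices: transpose, or conjugate transpose. -/
noncomputable def StarKind.mat {m k : Type*} : StarKind → Matrix m k ℂ → Matrix k m ℂ
  | .transpose, A => A.transpose
  | .conjTranspose, A => A.conjTranspose

/-- The quadratic matrix polynomial `Q(z) = z² A₁^⋆ + z A₀ + ε A₁`, evaluated at `z`. -/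
noncomputable def quadPoly {m : Type*} (st : StarKind) (ε : ℂ) (A₁ A₀ : Matrix m m ℂ) (z : ℂ) :
    Matrix m m ℂ :=
  z ^ 2 • st.mat A₁ + z • A₀ + ε • A₁

/-- `A₁, A₀` are the coefficients of a regular `⋆`-(anti)-palindromic system
`z² A₁^⋆ + z A₀ + ε A₁`: `A₁` is nonsingular and `A₀^⋆ = ε A₀`. -/
def IsRegularPalindromic {m : Type*} [Fintype m] [DecidableEq m] (st : StarKind) (ε : ℂ)
    (A₁ A₀ : Matrix m m ℂ) : Prop :=
  IsUnit A₁.det ∧ st.mat A₀ = ε • A₀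

/-- `𝕊_T`: the matrices `S` with `S^⋆ = -ε S` and `S = T S T^⋆`. -/
def paramSet {k : ℕ} (st : StarKind) (ε : ℂ) (T : Matrix (Fin k) (Fin k) ℂ) :
    Set (Matrix (Fin k) (Fin k) ℂ) :=
  {S | st.mat S = -(ε • S) ∧ S = T * S * st.mat T}

/-- `𝕊_{(X,T)}`: the matrices `S ∈ 𝕊_T` with `X S X^⋆ = 0`. -/
def paramSetPair {n k : ℕ} (st : StarKind) (ε : ℂ) (X : Matrix (Fin n) (Fin k) ℂ)
    (T : Matrix (Fin k) (Fin k) ℂ) : Set (Matrix (Fin k) (Fin k) ℂ) :=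
  {S | S ∈ paramSet st ε T ∧ X * S * st.mat X = 0}

/-- The square matrix `W(X,T)` of order `2n` with the `n` rows of `X` on top of those of
`-X T⁻¹`. -/
noncomputable def stackedMatrix {n : ℕ} (X : Matrix (Fin n) (Fin (2 * n)) ℂ)
    (T : Matrix (Fin (2 * n)) (Fin (2 * n)) ℂ) : Matrix (Fin (2 * n)) (Fin (2 * n)) ℂ :=
  (Matrix.fromRows X (-(X * T⁻¹))).submatrix
    ((finCongr (two_mul n)).trans finSumFinEquiv.symm) id

/-- `A₁ = ε (X T⁻¹ S X^⋆)⁻¹`. -/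
noncomputable def coeffOne {n k : ℕ} (st : StarKind) (ε : ℂ) (X : Matrix (Fin n) (Fin k) ℂ)
    (T S : Matrix (Fin k) (Fin k) ℂ) : Matrix (Fin n) (Fin n) ℂ :=
  ε • (X * T⁻¹ * S * st.mat X)⁻¹

/-- `A₀ = -A₁ X T⁻² S X^⋆ A₁`, where `A₁ = ε (X T⁻¹ S X^⋆)⁻¹`. -/
noncomputable def coeffZero {n k : ℕ} (st : StarKind) (ε : ℂ) (X : Matrix (Fin n) (Fin k) ℂ)
    (T S : Matrix (Fin k) (Fin k) ℂ) : Matrix (Fin n) (Fin n) ℂ :=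
  -(coeffOne st ε X T S * X * (T⁻¹ ^ 2) * S * st.mat X * coeffOne st ε X T S)

/-- The nilpotent matrix of order `k` with ones on the superdiagonal and zeros elsewhere. -/
def nilpotentBlock (k : ℕ) : Matrix (Fin k) (Fin k) ℂ :=
  Matrix.of fun a b => if a.val + 1 = b.val then 1 else 0

/-- The identification of the indices of consecutive square blocks of orders `s 0, s 1, …`,
stacked along the diagonal in this order, with the indices of a matrix of order `N = ∑ i, s i`. -/
def blockIndexEquiv {t N : ℕ} (s : Fin t → ℕ) (h : ∑ i, s i = N) :
    ((i : Fin t) × Fin (s i)) ≃ Fin N :=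
  finSigmaFinEquiv.trans (finCongr h)

/-- The block diagonal matrix `diag(B 0, B 1, …)` of order `N`, where `B i` has order `s i`. -/
def diagBlocks {t N : ℕ} (s : Fin t → ℕ) (h : ∑ i, s i = N)
    (B : (i : Fin t) → Matrix (Fin (s i)) (Fin (s i)) ℂ) : Matrix (Fin N) (Fin N) ℂ :=
  Matrix.reindex (blockIndexEquiv s h) (blockIndexEquiv s h) (Matrix.blockDiagonal' B)

/-- The data of a palindromic Jordan canonical form of order `N`: the distinct nonzero
eigenvalues `lam 0, …, lam (t-1)`, the first `2ℓ` of which come in consecutive pairs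
`(μ, 1/μ^⋆)` with `|μ| ≤ 1` and equal partial multiplicities, while the others satisfy
`μ = 1/μ^⋆` (that is `μ = ±1` if `⋆` is the transpose, and `|μ| = 1` if it is the conjugate
transpose); and the nonincreasing lists `part i` of the partial multiplicities of `lam i`. -/
structure PJCFData (st : StarKind) (N : ℕ) where
  t : ℕ
  ell : ℕ
  two_ell_le : 2 * ell ≤ t
  lam : Fin t → ℂ
  lam_injective : Function.Injective lam
  lam_ne_zero : ∀ i, lam i ≠ 0
  part : Fin t → List ℕ
  part_ne_nil : ∀ i, part i ≠ []
  part_pos : ∀ i, ∀ k ∈ part i, 0 < k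
  part_sorted : ∀ i, (part i).Pairwise (fun a b => b ≤ a)
  part_sum : ∑ i, ∑ j : Fin (part i).length, (part i).get j = N
  norm_le_one : ∀ i : Fin ell, ‖lam ⟨2 * i.val, by omega⟩‖ ≤ 1
  lam_pair : ∀ i : Fin ell,
    lam ⟨2 * i.val + 1, by omega⟩ = 1 / st.scalar (lam ⟨2 * i.val, by omega⟩)
  part_pair : ∀ i : Fin ell, part ⟨2 * i.val + 1, by omega⟩ = part ⟨2 * i.val, by omega⟩
  lam_self : ∀ i : Fin t, 2 * ell ≤ i.val → lam i * st.scalar (lam i) = 1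

/-- The matrix `diag(J₁, …, J_t)` with `J_i = lam i • 1 + diag(N_{i1}, N_{i2}, …)`, where `N_{ij}`
is the nilpotent block whose order is the `j`-th partial multiplicity of `lam i`. -/
noncomputable def PJCFData.toMatrix {st : StarKind} {N : ℕ} (d : PJCFData st N) :
    Matrix (Fin N) (Fin N) ℂ :=
  diagBlocks (fun i => ∑ j : Fin (d.part i).length, (d.part i).get j) d.part_sum
    fun i => d.lam i • (1 : Matrix _ _ ℂ) +
      diagBlocks (fun j => (d.part i).get j) rfl fun j => nilpotentBlock ((d.part i).get j)

/-- `J` is in palindromic Jordan canonical form. -/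
def IsPJCF {N : ℕ} (st : StarKind) (J : Matrix (Fin N) (Fin N) ℂ) : Prop :=
  ∃ d : PJCFData st N, J = d.toMatrix

/-- Every eigenvalue of `J` has geometric multiplicity one. -/
def GeomMultOne {N : ℕ} (J : Matrix (Fin N) (Fin N) ℂ) : Prop :=
  ∀ μ : ℂ, Module.End.HasEigenvalue (Matrix.toLin' J) μ →
    Module.finrank ℂ (Module.End.eigenspace (Matrix.toLin' J) μ) = 1

open Classical in
/-- The partition `ζ_n(M) = (n₁, …, n_t)`, up to the order of its parts. There is one part for each
class `{μ, μ^⋆}` of eigenvalues of `M`, and it is half the total algebraic multiplicity of the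
class. So if the eigenvalues of `M` are `μ` and `μ^⋆`, each `k` times, the part is `k` when
`μ ≠ μ^⋆`, and if `μ = μ^⋆` occurs `2k` times, the part is `k` as well. For `M = S̃ S⁻¹` with
nonsingular `S, S̃ ∈ 𝕊_{(X,T)}` these are the only cases, so that the division is exact. -/
noncomputable def zeta {N : ℕ} (st : StarKind) (M : Matrix (Fin N) (Fin N) ℂ) : Multiset ℕ :=
  (M.charpoly.roots.toFinset.image fun μ => ({μ, st.scalar μ} : Finset ℂ)).val.map
    fun c => (∑ μ ∈ c, M.charpoly.rootMultiplicity μ) / 2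

end Palindromic

/-!
Put `M = S' S⁻¹`. It commutes with `J`, because both `S` and `S'` solve `S = J S J^⋆`. As the rows of
`X` and `X J⁻¹` span the whole space and `X S' X^⋆ = 0`, there is an `n × n` matrix `U` with
`X M = U X` (`exists_mul_eq_mul`), hence also `X J⁻¹ M = U X J⁻¹`. So `M` is similar to `diag(U, U)`
and its characteristic polynomial is the square of that of `U` (`charpoly_eq_sq`): the parts of
`zeta st M` are the dimensions of the sums of generalized eigenspaces of `U` over the classes
`{μ, μ^⋆}`.

Since `J` is nonderogatory, its commutant is commutative
(`commute_of_commute_of_geomMultOne`, by means of a cyclic vector). Therefore `M` commutes with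
`Ŝ S⁻¹` for *every* nonsingular `Ŝ` in the parameter set, which gives `M Ŝ = Ŝ M^⋆`. It follows that
`U` intertwines all moments, `U (X J⁻ʲ Ŝ X^⋆) = (X J⁻ʲ Ŝ X^⋆) U^⋆` (`mul_moment_eq`), and hence that
`A U = U^⋆ A` for each coefficient `A` of the system defined by `Ŝ`.

For such an `A`, the form `x^⋆ A y` vanishes on generalized eigenvectors of `U` for `μ` and `ν` with
`μ^⋆ ≠ ν` (`mat_mul_mul_eq_zero_of_pow_mul_eq_zero`). If the columns of `K` are a basis of
generalized eigenvectors of `U` grouped by the classes, then `K^⋆ A K` is block diagonal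
(`exists_congruence_eq_diagBlocks`), and `K` depends on `U` only. That the coefficients define a
regular system at all is `isRegularPalindromic_coeff`.
-/

namespace Palindromic

/-! ### Nonderogatory endomorphisms have a commutative commutant -/

open Module Polynomial in
theorem finrank_ker_mul_le {K V : Type*} [Field K] [AddCommGroup V] [Module K V]
    [FiniteDimensional K V] (f g : End K V) :
    finrank K (LinearMap.ker (f * g)) ≤
      finrank K (LinearMap.ker f) + finrank K (LinearMap.ker g) := by
  have hmaps : ∀ x ∈ LinearMap.ker (f * g), g x ∈ LinearMap.ker f := fun x hx => by
    simpa using hx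
  have h := LinearMap.finrank_range_add_finrank_ker (g.restrict hmaps)
  have h1 : finrank K (LinearMap.range (g.restrict hmaps)) ≤ finrank K (LinearMap.ker f) :=
    Submodule.finrank_le _
  have h2 : finrank K (LinearMap.ker (g.restrict hmaps)) ≤ finrank K (LinearMap.ker g) := by
    refine LinearMap.finrank_le_finrank_of_injective
      (f := ((LinearMap.ker (f * g)).subtype.comp
        (LinearMap.ker (g.restrict hmaps)).subtype).codRestrict _ ?_) ?_
    · exact fun x => congrArg Subtype.val (LinearMap.mem_ker.1 x.2)
    · intro x y hxy
      have h : ((x : LinearMap.ker (f * g)) : V) = ((y : LinearMap.ker (f * g)) : V) :=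
        congrArg (fun z : LinearMap.ker g => (z : V)) hxy
      exact Subtype.ext (Subtype.ext h)
  omega

open Module Polynomial in
theorem finrank_ker_aeval_prod_X_sub_C_le {K V : Type*} [Field K] [AddCommGroup V] [Module K V]
    [FiniteDimensional K V] (f : End K V) (hf : ∀ μ, finrank K (f.eigenspace μ) ≤ 1)
    (s : Multiset K) :
    finrank K (LinearMap.ker (aeval f (s.map fun μ => X - C μ).prod)) ≤ s.card := by
  induction s using Multiset.induction_on with
  | empty =>
    rw [Multiset.map_zero, Multiset.prod_zero, map_one, Module.End.one_eq_id, LinearMap.ker_id]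
    simp
  | cons μ s ih =>
    rw [Multiset.map_cons, Multiset.prod_cons, map_mul, Multiset.card_cons, add_comm]
    refine (finrank_ker_mul_le _ _).trans (add_le_add ?_ ih)
    have := hf μ
    rwa [map_sub, aeval_X, aeval_C, Algebra.algebraMap_eq_smul_one, ← Module.End.eigenspace_def]

open Module Polynomial in
/-- If all eigenspaces are at most lines, the minimal polynomial has the largest possible degree:
it is a product of linear factors, each of which contributes at most one to the dimension of the
kernel. -/
theorem finrank_le_natDegree_minpoly {K V : Type*} [Field K] [IsAlgClosed K] [AddCommGroup V]
    [Module K V] [FiniteDimensional K V] (f : End K V)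
    (hf : ∀ μ, finrank K (f.eigenspace μ) ≤ 1) : finrank K V ≤ (minpoly K f).natDegree := by
  have hs := IsAlgClosed.splits (minpoly K f)
  have h := finrank_ker_aeval_prod_X_sub_C_le f hf (minpoly K f).roots
  rw [← hs.eq_prod_roots_of_monic (minpoly.monic (Algebra.IsIntegral.isIntegral f)),
    minpoly.aeval, LinearMap.ker_zero, finrank_top, ← hs.natDegree_eq_card_roots] at h
  exact h

open Module Polynomial in
/-- A vector whose annihilator in `K[X]` is generated by the minimal polynomial is cyclic. -/
theorem exists_cyclic_vector {K V : Type*} [Field K] [IsAlgClosed K] [AddCommGroup V]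
    [Module K V] [FiniteDimensional K V] (f : End K V)
    (hf : ∀ μ, finrank K (f.eigenspace μ) ≤ 1) :
    ∃ v : V, ∀ w : V, ∃ p : K[X], aeval f p v = w := by
  obtain ⟨x, hx⟩ := Module.exists_ker_toSpanSingleton_eq_annihilator K[X] (AEval' f)
  obtain ⟨v, rfl⟩ := (AEval'.of f).surjective x
  have hann : ∀ p : K[X], aeval f p v = 0 → minpoly K f ∣ p := by
    intro p hp
    rw [← Ideal.mem_span_singleton, span_minpoly_eq_annihilator, ← hx, LinearMap.mem_ker,
      LinearMap.toSpanSingleton_apply]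
    have := AEval.of_aeval_smul (R := K) (M := V) (a := f) p v
    rw [← this]
    simp [hp]
  let φ : degreeLT K (finrank K V) →ₗ[K] V :=
    ((LinearMap.applyₗ v).comp (aeval f).toLinearMap).comp (degreeLT K (finrank K V)).subtype
  have hinj : Function.Injective φ := by
    rw [← LinearMap.ker_eq_bot, LinearMap.ker_eq_bot']
    rintro ⟨p, hp⟩ h
    have hd := hann p h
    by_contra h0
    have hp0 : p ≠ 0 := fun h => h0 (Subtype.ext h)
    have h1 := natDegree_le_of_dvd hd hp0
    rw [mem_degreeLT, degree_eq_natDegree hp0, Nat.cast_lt] at hp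
    have := finrank_le_natDegree_minpoly f hf
    omega
  have hdim : finrank K (degreeLT K (finrank K V)) = finrank K V := by
    rw [(degreeLTEquiv K (finrank K V)).finrank_eq, finrank_fin_fun]
  have : FiniteDimensional K (degreeLT K (finrank K V)) :=
    (degreeLTEquiv K (finrank K V)).symm.finiteDimensional
  have hsurj := (LinearMap.injective_iff_surjective_of_finrank_eq_finrank hdim).1 hinj
  refine ⟨v, fun w => ?_⟩
  obtain ⟨⟨p, hp⟩, h⟩ := hsurj w
  exact ⟨p, h⟩

open Module Polynomial in
theorem commute_of_commute_of_finrank_eigenspace_le_one {K V : Type*} [Field K] [IsAlgClosed K]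
    [AddCommGroup V] [Module K V] [FiniteDimensional K V] (f : End K V)
    (hf : ∀ μ, finrank K (f.eigenspace μ) ≤ 1) {a b : End K V} (ha : Commute f a)
    (hb : Commute f b) : Commute a b := by
  obtain ⟨v, hv⟩ := exists_cyclic_vector f hf
  have key : ∀ c : End K V, Commute f c → ∃ p : K[X], c = aeval f p := by
    intro c hc
    -- `c` is determined by its value at the cyclic vector
    obtain ⟨p, hp⟩ := hv (c v)
    refine ⟨p, LinearMap.ext fun w => ?_⟩
    obtain ⟨q, rfl⟩ := hv w
    have h1 : Commute (aeval f q) c := by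
      induction q using Polynomial.induction_on' with
      | add p q hp hq => rw [map_add]; exact hp.add_left hq
      | monomial n a =>
        rw [aeval_monomial]
        exact (Algebra.commute_algebraMap_left a c).mul_left (hc.pow_left n)
    have h2 : Commute (aeval f q) (aeval f p) := (Commute.all q p).map (aeval f)
    have e1 := LinearMap.congr_fun h1.eq v
    have e2 := LinearMap.congr_fun h2.eq v
    simp only [Module.End.mul_apply] at e1 e2
    rw [← e1, ← e2, hp]
  obtain ⟨p, rfl⟩ := key a ha
  obtain ⟨q, rfl⟩ := key b hb
  exact (Commute.all p q).map (aeval f)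

theorem commute_of_commute_of_geomMultOne {N : ℕ} {J A B : Matrix (Fin N) (Fin N) ℂ}
    (hJ : Palindromic.GeomMultOne J) (hA : Commute J A) (hB : Commute J B) : Commute A B := by
  have hf : ∀ μ, Module.finrank ℂ (Module.End.eigenspace (Matrix.toLin' J) μ) ≤ 1 := by
    intro μ
    by_cases h : Module.End.HasEigenvalue (Matrix.toLin' J) μ
    · exact (hJ μ h).le
    · rw [Module.End.hasEigenvalue_iff, not_not] at h
      rw [h, finrank_bot]
      exact zero_le_one
  have h := commute_of_commute_of_finrank_eigenspace_le_one (Matrix.toLin' J) hf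
    (hA.map (Matrix.toLinAlgEquiv' (R := ℂ) (n := Fin N)))
    (hB.map (Matrix.toLinAlgEquiv' (R := ℂ) (n := Fin N)))
  exact Commute.of_map (Matrix.toLinAlgEquiv' (R := ℂ) (n := Fin N)).injective h

/-! ### The operation `⋆` -/

theorem StarKind.mat_apply {m k : Type*} (st : StarKind) (A : Matrix m k ℂ) (i : k) (j : m) :
    st.mat A i j = st.scalar (A j i) := by
  cases st <;> rfl

theorem StarKind.scalar_add (st : StarKind) (x y : ℂ) :
    st.scalar (x + y) = st.scalar x + st.scalar y := by
  cases st <;> simp [StarKind.scalar]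

theorem StarKind.scalar_mul (st : StarKind) (x y : ℂ) :
    st.scalar (x * y) = st.scalar x * st.scalar y := by
  cases st <;> simp [StarKind.scalar]

theorem StarKind.scalar_scalar (st : StarKind) (x : ℂ) : st.scalar (st.scalar x) = x := by
  cases st <;> simp [StarKind.scalar]

theorem StarKind.mat_mul {m k l : Type*} [Fintype k] (st : StarKind) (A : Matrix m k ℂ)
    (B : Matrix k l ℂ) : st.mat (A * B) = st.mat B * st.mat A := by
  cases st
  · exact Matrix.transpose_mul A B
  · exact Matrix.conjTranspose_mul A B

theorem StarKind.mat_add {m k : Type*} (st : StarKind) (A B : Matrix m k ℂ) :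
    st.mat (A + B) = st.mat A + st.mat B := by
  ext i j; simp [StarKind.mat_apply, StarKind.scalar_add]

theorem StarKind.mat_smul {m k : Type*} (st : StarKind) (c : ℂ) (A : Matrix m k ℂ) :
    st.mat (c • A) = st.scalar c • st.mat A := by
  ext i j; simp [StarKind.mat_apply, StarKind.scalar_mul]

theorem StarKind.mat_neg {m k : Type*} (st : StarKind) (A : Matrix m k ℂ) :
    st.mat (-A) = -st.mat A := by
  cases st
  · exact Matrix.transpose_neg A
  · exact Matrix.conjTranspose_neg A

theorem StarKind.mat_sub {m k : Type*} (st : StarKind) (A B : Matrix m k ℂ) :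
    st.mat (A - B) = st.mat A - st.mat B := by
  rw [sub_eq_add_neg, mat_add, mat_neg, sub_eq_add_neg]

theorem StarKind.mat_zero {m k : Type*} (st : StarKind) :
    st.mat (0 : Matrix m k ℂ) = 0 := by
  cases st
  · exact Matrix.transpose_zero
  · exact Matrix.conjTranspose_zero

theorem StarKind.mat_one {m : Type*} [DecidableEq m] (st : StarKind) :
    st.mat (1 : Matrix m m ℂ) = 1 := by
  cases st
  · exact Matrix.transpose_one
  · exact Matrix.conjTranspose_one

theorem StarKind.mat_mat {m k : Type*} (st : StarKind) (A : Matrix m k ℂ) :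
    st.mat (st.mat A) = A := by
  cases st
  · exact Matrix.transpose_transpose A
  · exact Matrix.conjTranspose_conjTranspose A

theorem StarKind.mat_inv {m : Type*} [Fintype m] [DecidableEq m] (st : StarKind)
    (A : Matrix m m ℂ) : st.mat A⁻¹ = (st.mat A)⁻¹ := by
  cases st
  · exact Matrix.transpose_nonsing_inv A
  · exact Matrix.conjTranspose_nonsing_inv A

theorem StarKind.isUnit_det_mat {m : Type*} [Fintype m] [DecidableEq m] (st : StarKind)
    {A : Matrix m m ℂ} (h : IsUnit A.det) : IsUnit (st.mat A).det := by
  cases st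
  · exact (Matrix.isUnit_det_transpose A h)
  · rw [StarKind.mat, Matrix.det_conjTranspose]; exact h.star

/-! ### Block diagonalization by generalized eigenvectors -/

/-- Vectors from generalized eigenspaces of `U` whose eigenvalues are not interchanged by `⋆` are
orthogonal for every form `x, y ↦ x^⋆ A y` for which `U` is self-adjoint. -/
theorem mat_mul_mul_eq_zero_of_pow_mul_eq_zero {m a b : Type*} [Fintype m] [DecidableEq m]
    (st : StarKind) {U A : Matrix m m ℂ} (hA : A * U = st.mat U * A) {μ ν : ℂ}
    (hμν : st.scalar μ ≠ ν) (k l : ℕ) (x : Matrix m a ℂ) (y : Matrix m b ℂ)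
    (hx : (U - μ • 1) ^ k * x = 0) (hy : (U - ν • 1) ^ l * y = 0) :
    st.mat x * A * y = 0 := by
  -- By induction on `k + l`: both `(U - μ) x` and `(U - ν) y` have smaller height, and moving `U`
  -- across the form shows that the two values differ by `(ν - μ^⋆) x^⋆ A y`.
  suffices H : ∀ N k l : ℕ, k + l ≤ N → ∀ (x : Matrix m a ℂ) (y : Matrix m b ℂ),
      (U - μ • 1) ^ k * x = 0 → (U - ν • 1) ^ l * y = 0 → st.mat x * A * y = 0 from
    H _ k l le_rfl x y hx hy
  intro N
  induction N with
  | zero =>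
    intro k l hkl x y hx hy
    obtain rfl : k = 0 := by omega
    rw [pow_zero, Matrix.one_mul] at hx
    rw [hx, StarKind.mat_zero, Matrix.zero_mul, Matrix.zero_mul]
  | succ N ih =>
    intro k l hkl x y hx hy
    rcases k with _ | k
    · rw [pow_zero, Matrix.one_mul] at hx
      rw [hx, StarKind.mat_zero, Matrix.zero_mul, Matrix.zero_mul]
    rcases l with _ | l
    · rw [pow_zero, Matrix.one_mul] at hy
      rw [hy, Matrix.mul_zero]
    have h1 := ih k (l + 1) (by omega) ((U - μ • 1) * x) y
      (by rw [← Matrix.mul_assoc, ← pow_succ, hx]) hy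
    have h2 := ih (k + 1) l (by omega) x ((U - ν • 1) * y) hx
      (by rw [← Matrix.mul_assoc, ← pow_succ, hy])
    have h3 : st.mat ((U - μ • 1) * x) * A * y =
        st.mat x * A * ((U - ν • 1) * y) + (ν - st.scalar μ) • (st.mat x * A * y) := by
      have : st.mat x * A * (U * y) = st.mat x * st.mat U * A * y := by
        rw [← Matrix.mul_assoc, Matrix.mul_assoc _ A, hA, ← Matrix.mul_assoc]
      rw [StarKind.mat_mul, StarKind.mat_sub, StarKind.mat_smul, StarKind.mat_one]
      simp only [Matrix.mul_sub, Matrix.sub_mul, Matrix.mul_smul, Matrix.smul_mul, Matrix.mul_one,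
        Matrix.one_mul, this, sub_smul]
      abel
    rw [h1, h2, zero_add, eq_comm, smul_eq_zero] at h3
    exact h3.resolve_left (sub_ne_zero.2 hμν.symm)

/-- A basis of generalized eigenvectors of `U`, ordered by a grouping `c` of the eigenvalues. -/
theorem exists_basis_mem_maxGenEigenspace {n t : ℕ} (U : Matrix (Fin n) (Fin n) ℂ)
    (c : Fin t → Finset ℂ) (hdisj : Pairwise fun i j => Disjoint (c i) (c j))
    (hcov : ∀ μ ∈ U.charpoly.roots, ∃ i, μ ∈ c i) (ns : Fin t → ℕ)
    (hns : ∀ i, ns i = ∑ μ ∈ c i, U.charpoly.rootMultiplicity μ) :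
    ∃ b : Module.Basis ((i : Fin t) × Fin (ns i)) ℂ (Fin n → ℂ),
      ∀ p, ∃ μ ∈ c p.1, b p ∈ Module.End.maxGenEigenspace (Matrix.toLin' U) μ := by
  classical
  let f : Module.End ℂ (Fin n → ℂ) := Matrix.toLin' U
  have hint : DirectSum.IsInternal f.maxGenEigenspace :=
    DirectSum.isInternal_submodule_of_iSupIndep_of_iSup_eq_top f.independent_maxGenEigenspace
      f.iSup_maxGenEigenspace_eq_top
  have hfr : ∀ μ, Module.finrank ℂ (f.maxGenEigenspace μ) = U.charpoly.rootMultiplicity μ := by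
    intro μ
    rw [LinearMap.finrank_maxGenEigenspace_eq, Matrix.charpoly_toLin']
  let b₀ := hint.collectedBasis fun μ => Module.finBasisOfFinrankEq ℂ _ (hfr μ)
  have hcard : ∀ i, Fintype.card (Fin (ns i)) =
      Fintype.card ((μ : c i) × Fin (U.charpoly.rootMultiplicity (μ : ℂ))) := by
    intro i
    rw [Fintype.card_sigma, Fintype.card_fin, hns i, ← Finset.sum_coe_sort]
    simp
  let e := fun i => Fintype.equivOfCardEq (hcard i)
  let g : ((i : Fin t) × Fin (ns i)) → ((μ : ℂ) × Fin (U.charpoly.rootMultiplicity μ)) :=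
    fun p => ⟨(e p.1 p.2).1, (e p.1 p.2).2⟩
  have hginj : Function.Injective g := by
    rintro ⟨i, a⟩ ⟨j, b⟩ h
    have hμ : ((e i a).1 : ℂ) = (e j b).1 := congrArg Sigma.fst h
    have hij : i = j := by
      by_contra hne
      exact Finset.disjoint_left.1 (hdisj hne) (e i a).1.2 (hμ ▸ (e j b).1.2)
    subst hij
    have hval : Function.Injective (Sigma.map (β₂ := fun μ : ℂ => Fin (U.charpoly.rootMultiplicity μ))
        Subtype.val fun (μ : c i) (x : Fin (U.charpoly.rootMultiplicity (μ : ℂ))) => x) :=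
      Subtype.val_injective.sigma_map fun _ => Function.injective_id
    exact congrArg (Sigma.mk i) ((e i).injective (hval h))
  have hgsurj : Function.Surjective g := by
    rintro ⟨μ, x⟩
    have hμ : μ ∈ U.charpoly.roots := by
      rw [← Multiset.count_pos, Polynomial.count_roots]
      exact x.pos
    obtain ⟨i, hi⟩ := hcov μ hμ
    refine ⟨⟨i, (e i).symm ⟨⟨μ, hi⟩, x⟩⟩, ?_⟩
    change (⟨(e i ((e i).symm ⟨⟨μ, hi⟩, x⟩)).1, (e i ((e i).symm ⟨⟨μ, hi⟩, x⟩)).2⟩ :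
      (μ : ℂ) × Fin (U.charpoly.rootMultiplicity μ)) = ⟨μ, x⟩
    rw [Equiv.apply_symm_apply]
  refine ⟨b₀.reindex (Equiv.ofBijective g ⟨hginj, hgsurj⟩).symm, fun p => ?_⟩
  refine ⟨(e p.1 p.2).1, (e p.1 p.2).1.2, ?_⟩
  rw [Module.Basis.reindex_apply, Equiv.symm_symm]
  exact hint.collectedBasis_mem _ (g p)

/-- The `i`-th diagonal block of `M`, for consecutive diagonal blocks of orders `s 0, s 1, …`. -/
def diagPart {t N : ℕ} (s : Fin t → ℕ) (h : ∑ i, s i = N) (M : Matrix (Fin N) (Fin N) ℂ)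
    (i : Fin t) : Matrix (Fin (s i)) (Fin (s i)) ℂ :=
  M.submatrix (fun a => blockIndexEquiv s h ⟨i, a⟩) (fun a => blockIndexEquiv s h ⟨i, a⟩)

theorem eq_diagBlocks_diagPart {t N : ℕ} (s : Fin t → ℕ) (h : ∑ i, s i = N)
    (M : Matrix (Fin N) (Fin N) ℂ)
    (hM : ∀ i j, i ≠ j → ∀ (a : Fin (s i)) (b : Fin (s j)),
      M (blockIndexEquiv s h ⟨i, a⟩) (blockIndexEquiv s h ⟨j, b⟩) = 0) :
    M = diagBlocks s h (diagPart s h M) := by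
  ext p q
  obtain ⟨⟨i, a⟩, rfl⟩ := (blockIndexEquiv s h).surjective p
  obtain ⟨⟨j, b⟩, rfl⟩ := (blockIndexEquiv s h).surjective q
  rw [diagBlocks, Matrix.reindex_apply, Matrix.submatrix_apply, Equiv.symm_apply_apply,
    Equiv.symm_apply_apply]
  by_cases hij : i = j
  · subst hij
    rw [Matrix.blockDiagonal'_apply_eq]
    rfl
  · rw [Matrix.blockDiagonal'_apply_ne _ _ _ hij, hM i j hij]

theorem det_diagBlocks {t N : ℕ} (s : Fin t → ℕ) (h : ∑ i, s i = N)
    (B : (i : Fin t) → Matrix (Fin (s i)) (Fin (s i)) ℂ) :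
    (diagBlocks s h B).det = ∏ i, (B i).det := by
  rw [diagBlocks, Matrix.det_reindex_self, (Matrix.blockTriangular_blockDiagonal' B).det_fintype]
  refine Finset.prod_congr rfl fun i _ => ?_
  rw [← Matrix.det_reindex_self (Equiv.sigmaSubtype i)]
  congr 1
  ext a b
  exact Matrix.blockDiagonal'_apply_eq B i a b

/-- If the eigenvalues of `U` are grouped into disjoint sets stable under `⋆`, a single
congruence block-diagonalizes all matrices `A` with `A U = U^⋆ A`. -/
theorem exists_congruence_eq_diagBlocks {n t : ℕ} (st : StarKind) (U : Matrix (Fin n) (Fin n) ℂ)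
    (c : Fin t → Finset ℂ) (hdisj : Pairwise fun i j => Disjoint (c i) (c j))
    (hstar : ∀ i, ∀ μ ∈ c i, st.scalar μ ∈ c i)
    (hcov : ∀ μ ∈ U.charpoly.roots, ∃ i, μ ∈ c i) (ns : Fin t → ℕ)
    (hns : ∀ i, ns i = ∑ μ ∈ c i, U.charpoly.rootMultiplicity μ) :
    ∃ (hsum : ∑ i, ns i = n) (K : Matrix (Fin n) (Fin n) ℂ), IsUnit K.det ∧
      ∀ A : Matrix (Fin n) (Fin n) ℂ, A * U = st.mat U * A →
        st.mat K * A * K = diagBlocks ns hsum (diagPart ns hsum (st.mat K * A * K)) := by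
  obtain ⟨b, hb⟩ := exists_basis_mem_maxGenEigenspace U c hdisj hcov ns hns
  have hsum : ∑ i, ns i = n := by
    have := Module.finrank_eq_card_basis b
    rw [Module.finrank_fin_fun, Fintype.card_sigma] at this
    simpa using this.symm
  let b' := b.reindex (blockIndexEquiv ns hsum)
  let K : Matrix (Fin n) (Fin n) ℂ := (Pi.basisFun ℂ (Fin n)).toMatrix b'
  have hK : ∀ r p, K r p = b' p r := fun r p => by
    simp [K, Module.Basis.toMatrix_apply]
  refine ⟨hsum, K, ?_, fun A hA => eq_diagBlocks_diagPart _ _ _ fun i j hij a a' => ?_⟩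
  · have : Invertible K := (Pi.basisFun ℂ (Fin n)).invertibleToMatrix b'
    exact (Matrix.isUnit_iff_isUnit_det K).1 (isUnit_of_invertible K)
  · obtain ⟨μ, hμ, hbμ⟩ := hb ⟨i, a⟩
    obtain ⟨ν, hν, hbν⟩ := hb ⟨j, a'⟩
    have hne : st.scalar μ ≠ ν := fun h =>
      Finset.disjoint_left.1 (hdisj hij) (hstar i μ hμ) (h ▸ hν)
    rw [Module.End.mem_maxGenEigenspace] at hbμ hbν
    obtain ⟨k, hk⟩ := hbμ
    obtain ⟨l, hl⟩ := hbν
    have hpow : ∀ (τ : ℂ) (k : ℕ) (v : Fin n → ℂ),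
        ((Matrix.toLin' U - τ • 1 : Module.End ℂ (Fin n → ℂ)) ^ k) v = 0 →
          (U - τ • 1) ^ k * Matrix.replicateCol Unit v = 0 := by
      intro τ k v h
      have h1 : (Matrix.toLin' U - τ • 1 : Module.End ℂ (Fin n → ℂ)) ^ k =
          Matrix.toLinAlgEquiv' ((U - τ • 1) ^ k) := by
        rw [map_pow, map_sub, map_smul, map_one]
        rfl
      rw [h1, Matrix.toLinAlgEquiv'_apply] at h
      rw [← Matrix.replicateCol_mulVec, h, Matrix.replicateCol_zero]
    have h := mat_mul_mul_eq_zero_of_pow_mul_eq_zero st hA hne k l _ _ (hpow _ _ _ hk)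
      (hpow _ _ _ hl)
    have hcol : ∀ p, Matrix.replicateCol Unit (b p) =
        K.submatrix id (fun _ => blockIndexEquiv ns hsum p) := by
      intro p
      ext r u
      simp [hK, b']
    rw [hcol, hcol] at h
    have h' := congrFun (congrFun h ()) ()
    rw [Matrix.zero_apply] at h'
    rw [← h']
    simp [Matrix.mul_apply, StarKind.mat_apply]

/-! ### The classes counted by `zeta` -/

theorem card_fiber_eq_count {ι : Type*} [Fintype ι] (g : ι → ℕ) (k : ℕ) :
    Fintype.card {a // g a = k} = (Finset.univ.val.map g).count k := by
  rw [Fintype.card_subtype, Multiset.count_map, Finset.card_def, Finset.filter_val]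
  simp only [eq_comm]

/-- Two families with the same multiset of values are reindexings of each other. -/
theorem exists_equiv_of_map_val_eq {α ι : Type*} [Fintype ι] (C : Finset α) (f : α → ℕ)
    (g : ι → ℕ) (h : C.val.map f = Finset.univ.val.map g) :
    ∃ e : ι ≃ C, ∀ i, g i = f (e i) := by
  have hC : (Finset.univ : Finset C).val.map (fun x : C => f x.1) = C.val.map f := by
    conv_rhs => rw [← Multiset.attach_map_val C.val, Multiset.map_map]
    rfl
  have hfib : ∀ k, Nonempty ({i // g i = k} ≃ {x : C // f x.1 = k}) := fun k =>
    ⟨Fintype.equivOfCardEq (by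
      rw [card_fiber_eq_count, card_fiber_eq_count (fun x : C => f x.1), hC, h])⟩
  exact ⟨Equiv.ofFiberEquiv fun k => (hfib k).some,
    fun i => (Equiv.ofFiberEquiv_map (fun k => (hfib k).some) i).symm⟩

/-- The parts of `zeta` are indexed by disjoint `⋆`-stable sets of scalars that contain all
eigenvalues. -/
theorem exists_classes_of_zeta_eq {N t : ℕ} (st : StarKind) (M : Matrix (Fin N) (Fin N) ℂ)
    (ns : Fin t → ℕ) (hns : zeta st M = Finset.univ.val.map ns) :
    ∃ c : Fin t → Finset ℂ, (Pairwise fun i j => Disjoint (c i) (c j)) ∧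
      (∀ i, ∀ μ ∈ c i, st.scalar μ ∈ c i) ∧ (∀ μ ∈ M.charpoly.roots, ∃ i, μ ∈ c i) ∧
      ∀ i, ns i = (∑ μ ∈ c i, M.charpoly.rootMultiplicity μ) / 2 := by
  classical
  obtain ⟨e, he⟩ := exists_equiv_of_map_val_eq _ _ _ hns
  have hmem : ∀ i, ∃ μ : ℂ, ((e i : Finset ℂ)) = {μ, st.scalar μ} := by
    intro i
    obtain ⟨μ, -, hμ⟩ := Finset.mem_image.1 (e i).2
    refine ⟨μ, ?_⟩
    rw [← hμ]
  refine ⟨fun i => e i, fun i j hij => ?_, fun i μ hμ => ?_, fun μ hμ => ?_, he⟩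
  · refine Finset.disjoint_left.2 fun {ν} hi hj => ?_
    refine hij (e.injective (Subtype.ext ?_))
    -- a class is determined by any of its elements
    have key : ∀ i, ν ∈ (e i : Finset ℂ) → (e i : Finset ℂ) = {ν, st.scalar ν} := by
      intro i hν
      obtain ⟨μ, hμ⟩ := hmem i
      rw [hμ, Finset.mem_insert, Finset.mem_singleton] at hν
      rcases hν with rfl | rfl
      · exact hμ
      · rw [StarKind.scalar_scalar, hμ, Finset.pair_comm]
    rw [key i hi, key j hj]
  · obtain ⟨ν, hν⟩ := hmem i
    simp only [hν, Finset.mem_insert, Finset.mem_singleton] at hμ ⊢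
    rcases hμ with rfl | rfl
    · exact Or.inr rfl
    · exact Or.inl (StarKind.scalar_scalar st ν)
  · refine ⟨e.symm ⟨{μ, st.scalar μ}, ?_⟩, ?_⟩
    · exact Finset.mem_image.2 ⟨μ, Multiset.mem_toFinset.2 hμ, by congr⟩
    · change μ ∈ (e (e.symm _) : Finset ℂ)
      rw [Equiv.apply_symm_apply]
      exact Finset.mem_insert_self _ _

/-! ### Moments of a pair `(X, J)` -/

section Pair

variable {n : ℕ} {st : StarKind} {ε : ℂ} {X : Matrix (Fin n) (Fin (2 * n)) ℂ}
  {J S : Matrix (Fin (2 * n)) (Fin (2 * n)) ℂ}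

theorem eps_mul_eps (hε : ε = 1 ∨ ε = -1) : ε * ε = 1 := by
  rcases hε with rfl | rfl <;> norm_num

/-- The rows of `X` and `X J⁻¹` span the row space. -/
theorem exists_eq_mul_add_mul {k : ℕ} (hW : IsUnit (stackedMatrix X J).det)
    (Y : Matrix (Fin k) (Fin (2 * n)) ℂ) :
    ∃ A B : Matrix (Fin k) (Fin n) ℂ, Y = A * X + B * (X * J⁻¹) := by
  let e := (finCongr (two_mul n)).trans finSumFinEquiv.symm
  let Z := (Y * (stackedMatrix X J)⁻¹).submatrix id e.symm
  refine ⟨Z.toCols₁, -Z.toCols₂, ?_⟩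
  have h : Z * Matrix.fromRows X (-(X * J⁻¹)) = Y := by
    have h1 : Matrix.fromRows X (-(X * J⁻¹)) = (stackedMatrix X J).submatrix e.symm id := by
      ext a b
      simp [stackedMatrix, e]
    rw [h1, Matrix.submatrix_mul_equiv, Matrix.mul_assoc, Matrix.nonsing_inv_mul _ hW,
      Matrix.mul_one, Matrix.submatrix_id_id]
  rw [← Matrix.fromCols_toCols Z, Matrix.fromCols_mul_fromRows] at h
  rw [← h, Matrix.mul_neg, Matrix.neg_mul]

theorem exists_mul_inv_mul_eq_one (hW : IsUnit (stackedMatrix X J).det) :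
    ∃ R : Matrix (Fin (2 * n)) (Fin n) ℂ, X * J⁻¹ * R = 1 := by
  let e := (finCongr (two_mul n)).trans finSumFinEquiv.symm
  refine ⟨-((stackedMatrix X J)⁻¹.submatrix id fun a => e.symm (Sum.inr a)), ?_⟩
  ext a b
  have h := congrFun (congrFun (Matrix.mul_nonsing_inv _ hW) (e.symm (Sum.inr a)))
    (e.symm (Sum.inr b))
  have h1 : ∀ k, stackedMatrix X J (e.symm (Sum.inr a)) k = -(X * J⁻¹) a k := by
    intro k
    change Matrix.fromRows X (-(X * J⁻¹)) (e (e.symm (Sum.inr a))) k = _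
    rw [Equiv.apply_symm_apply]
    rfl
  rw [Matrix.mul_apply, Finset.sum_congr rfl fun k _ => by rw [h1 k]] at h
  rw [Matrix.mul_apply]
  simpa [Matrix.one_apply] using h

theorem isUnit_det_of_mem_paramSet (hS : S ∈ paramSet st ε J) (hdet : IsUnit S.det) :
    IsUnit J.det := by
  have h := congrArg Matrix.det hS.2
  rw [Matrix.det_mul, Matrix.det_mul] at h
  rw [h] at hdet
  exact isUnit_of_mul_isUnit_left (isUnit_of_mul_isUnit_left hdet)

theorem inv_mul_eq_mul_mat (hJ : IsUnit J.det) (hS : S ∈ paramSet st ε J) :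
    J⁻¹ * S = S * st.mat J := by
  conv_lhs => rw [hS.2]
  rw [Matrix.mul_assoc J, Matrix.nonsing_inv_mul_cancel_left _ _ hJ]

theorem mul_mat_inv_eq_mul (hJ : IsUnit J.det) (hS : S ∈ paramSet st ε J) :
    S * (st.mat J)⁻¹ = J * S := by
  conv_lhs => rw [hS.2]
  rw [Matrix.mul_nonsing_inv_cancel_right _ _ (st.isUnit_det_mat hJ)]

/-- The matrix inverted in `coeffOne` is nonsingular: since `X J⁻¹ S (X J⁻¹)^⋆ = X S X^⋆ = 0`, a
preimage of `1` under `X J⁻¹ S`, expanded in `X^⋆` and `(X J⁻¹)^⋆`, yields a right inverse of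
`X J⁻¹ S X^⋆`. -/
theorem isUnit_det_mul_inv_mul_mat (hW : IsUnit (stackedMatrix X J).det)
    (hS : S ∈ paramSetPair st ε X J) (hdet : IsUnit S.det) :
    IsUnit (X * J⁻¹ * S * st.mat X).det := by
  have hJ := isUnit_det_of_mem_paramSet hS.1 hdet
  obtain ⟨R, hR⟩ := exists_mul_inv_mul_eq_one hW
  obtain ⟨A, B, hAB⟩ := exists_eq_mul_add_mul hW (st.mat (S⁻¹ * R))
  have h := congrArg st.mat hAB
  rw [st.mat_mat, st.mat_add, st.mat_mul, st.mat_mul B] at h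
  have h0 : X * J⁻¹ * S * st.mat (X * J⁻¹) = 0 := by
    rw [st.mat_mul, st.mat_inv, Matrix.mul_assoc X, inv_mul_eq_mul_mat hJ hS.1,
      ← Matrix.mul_assoc, ← Matrix.mul_assoc, Matrix.mul_nonsing_inv_cancel_right _ _
      (st.isUnit_det_mat hJ), hS.2]
  have h1 : X * J⁻¹ * S * st.mat X * st.mat A = 1 := by
    have h2 : X * J⁻¹ * S * (S⁻¹ * R) = 1 := by
      rw [← Matrix.mul_assoc, Matrix.mul_nonsing_inv_cancel_right _ _ hdet, hR]
    rw [h, Matrix.mul_add, ← Matrix.mul_assoc, ← Matrix.mul_assoc _ (st.mat (X * J⁻¹)), h0,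
      Matrix.zero_mul, add_zero] at h2
    exact h2
  exact Matrix.isUnit_det_of_right_inverse h1

/-- If `S T^⋆ = T' S`, as for `T = J⁻ʲ` and `T' = Jʲ`, then `⋆` maps the moment of `T` to
`-ε` times that of `T'`. -/
theorem mat_moment (hS : S ∈ paramSet st ε J) (T : Matrix (Fin (2 * n)) (Fin (2 * n)) ℂ)
    {T' : Matrix (Fin (2 * n)) (Fin (2 * n)) ℂ} (hT : S * st.mat T = T' * S) :
    st.mat (X * T * S * st.mat X) = -(ε • (X * T' * S * st.mat X)) := by
  rw [st.mat_mul, st.mat_mat, st.mat_mul, hS.1, st.mat_mul, Matrix.neg_mul, Matrix.mul_neg,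
    Matrix.smul_mul, Matrix.mul_smul, ← Matrix.mul_assoc S, hT]
  simp only [Matrix.mul_assoc]

theorem coeffZero_eq (hε : ε = 1 ∨ ε = -1) :
    coeffZero st ε X J S = -((X * J⁻¹ * S * st.mat X)⁻¹ * (X * J⁻¹ ^ 2 * S * st.mat X) *
      (X * J⁻¹ * S * st.mat X)⁻¹) := by
  rw [coeffZero, coeffOne]
  simp only [Matrix.smul_mul, Matrix.mul_smul, smul_smul, eps_mul_eps hε, one_smul,
    Matrix.mul_assoc]

/-- The symmetry of `A₀` amounts to `Γ₂ = -Γ₁ Γ₋₁⁻¹ Γ₋₂ Γ₋₁⁻¹ Γ₁` for the moments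
`Γⱼ = X Jʲ S X^⋆`. This follows by eliminating `A` and `B` from `X J = A X + B X J⁻¹`, using
`Γ₀ = 0`. -/
theorem isRegularPalindromic_coeff (hε : ε = 1 ∨ ε = -1)
    (hW : IsUnit (stackedMatrix X J).det) (hS : S ∈ paramSetPair st ε X J)
    (hdet : IsUnit S.det) :
    IsRegularPalindromic st ε (coeffOne st ε X J S) (coeffZero st ε X J S) := by
  have hJ := isUnit_det_of_mem_paramSet hS.1 hdet
  have hP := isUnit_det_mul_inv_mul_mat hW hS hdet
  have hεu : IsUnit ε := IsUnit.of_mul_eq_one _ (eps_mul_eps hε)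
  refine ⟨?_, ?_⟩
  · rw [coeffOne, Matrix.det_smul]
    exact (hεu.pow _).mul (Matrix.isUnit_nonsing_inv_det _ hP)
  · have hPs := st.isUnit_det_mat hP
    have hinv := mul_mat_inv_eq_mul hJ hS.1
    have h1 : st.mat (X * J⁻¹ * S * st.mat X) = -(ε • (X * J * S * st.mat X)) :=
      mat_moment hS.1 _ (by rw [st.mat_inv, hinv])
    have h2 : st.mat (X * J⁻¹ ^ 2 * S * st.mat X) = -(ε • (X * (J * J) * S * st.mat X)) :=
      mat_moment hS.1 _ (by
        rw [pow_two, st.mat_mul, st.mat_inv, ← Matrix.mul_assoc, hinv, Matrix.mul_assoc, hinv,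
          Matrix.mul_assoc])
    obtain ⟨A, B, hAB⟩ := exists_eq_mul_add_mul hW (X * J)
    -- the three moments of the relation `X J = A X + B X J⁻¹`
    have m1 : X * J * S * st.mat X = B * (X * J⁻¹ * S * st.mat X) := by
      have h0 : A * (X * S * st.mat X) = 0 := by rw [hS.2, Matrix.mul_zero]
      rw [hAB, Matrix.add_mul, Matrix.add_mul]
      simp only [Matrix.mul_assoc] at h0 ⊢
      rw [h0, zero_add]
    have m0 : A * (X * J⁻¹ * S * st.mat X) + B * (X * J⁻¹ ^ 2 * S * st.mat X) = 0 := by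
      have h : X * J * (J⁻¹ * S * st.mat X) = 0 := by
        rw [← hS.2, Matrix.mul_assoc J⁻¹, Matrix.mul_assoc X J,
          Matrix.mul_nonsing_inv_cancel_left _ _ hJ, Matrix.mul_assoc]
      rw [hAB, Matrix.add_mul] at h
      rw [← h, pow_two]
      simp only [Matrix.mul_assoc]
    have m2 : X * (J * J) * S * st.mat X = A * (X * J * S * st.mat X) := by
      have h0 : B * (X * S * st.mat X) = 0 := by rw [hS.2, Matrix.mul_zero]
      have : B * (X * J⁻¹) * (J * (S * st.mat X)) = 0 := by
        rw [← h0, Matrix.mul_assoc, Matrix.mul_assoc,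
          Matrix.nonsing_inv_mul_cancel_left _ _ hJ, Matrix.mul_assoc]
      calc X * (J * J) * S * st.mat X = X * J * (J * (S * st.mat X)) := by
            simp only [Matrix.mul_assoc]
        _ = A * X * (J * (S * st.mat X)) := by rw [hAB, Matrix.add_mul, this, add_zero]
        _ = _ := by simp only [Matrix.mul_assoc]
    rw [coeffZero_eq hε, st.mat_neg, st.mat_mul, st.mat_mul, st.mat_inv]
    generalize X * J⁻¹ * S * st.mat X = P at *
    generalize X * J⁻¹ ^ 2 * S * st.mat X = Q at *
    generalize X * (J * J) * S * st.mat X = G₂ at *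
    generalize X * J * S * st.mat X = G₁ at *
    have hB : B = G₁ * P⁻¹ := by rw [m1, Matrix.mul_nonsing_inv_cancel_right _ _ hP]
    have hA : A = -(G₁ * P⁻¹ * Q * P⁻¹) := by
      rw [← hB, ← Matrix.neg_mul, ← eq_neg_of_add_eq_zero_left m0,
        Matrix.mul_nonsing_inv_cancel_right _ _ hP]
    have key : st.mat Q = ε • (st.mat P * (P⁻¹ * Q * P⁻¹) * st.mat P) := by
      rw [h2, h1, m2, hA]
      simp only [Matrix.neg_mul, Matrix.mul_neg, neg_neg, Matrix.smul_mul, Matrix.mul_smul,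
        smul_neg, smul_smul, eps_mul_eps hε, mul_one, Matrix.mul_assoc]
    rw [key, Matrix.smul_mul, Matrix.mul_smul, Matrix.mul_nonsing_inv_cancel_right _ _ hPs,
      Matrix.nonsing_inv_mul_cancel_left _ _ hPs, smul_neg]

theorem commute_mul_inv (hJ : IsUnit J.det) {S' : Matrix (Fin (2 * n)) (Fin (2 * n)) ℂ}
    (hS : S ∈ paramSet st ε J) (hdet : IsUnit S.det) (hS' : S' ∈ paramSet st ε J) :
    Commute J (S' * S⁻¹) := by
  have h1 : S⁻¹ * J = st.mat J⁻¹ * S⁻¹ := by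
    have h := congrArg (fun Z => S⁻¹ * Z * S⁻¹) (mul_mat_inv_eq_mul hJ hS)
    simp only [← Matrix.mul_assoc] at h
    rw [Matrix.nonsing_inv_mul _ hdet, Matrix.one_mul,
      Matrix.mul_nonsing_inv_cancel_right _ _ hdet] at h
    rw [st.mat_inv, h]
  change J * (S' * S⁻¹) = S' * S⁻¹ * J
  rw [Matrix.mul_assoc S', h1, ← Matrix.mul_assoc, ← Matrix.mul_assoc, st.mat_inv,
    mul_mat_inv_eq_mul hJ hS']

theorem mul_mat_mul_inv (hε : ε = 1 ∨ ε = -1) {S' : Matrix (Fin (2 * n)) (Fin (2 * n)) ℂ}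
    (hS : S ∈ paramSet st ε J) (hdet : IsUnit S.det) (hS' : S' ∈ paramSet st ε J) :
    S * st.mat (S' * S⁻¹) = S' := by
  have h : S = -(ε • st.mat S) := by
    rw [hS.1, smul_neg, smul_smul, eps_mul_eps hε, one_smul, neg_neg]
  rw [st.mat_mul, st.mat_inv]
  conv_lhs => lhs; rw [h]
  rw [Matrix.neg_mul, Matrix.smul_mul, Matrix.mul_nonsing_inv_cancel_left _ _
    (st.isUnit_det_mat hdet), hS'.1, smul_neg, smul_smul, eps_mul_eps hε, one_smul, neg_neg]

/-- Write `X S' S⁻¹ = A X + B X J⁻¹`; multiplication by `S X^⋆` gives `0 = B (X J⁻¹ S X^⋆)`, so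
that `B = 0`. -/
theorem exists_mul_eq_mul (hW : IsUnit (stackedMatrix X J).det)
    (hS : S ∈ paramSetPair st ε X J) (hdet : IsUnit S.det)
    {S' : Matrix (Fin (2 * n)) (Fin (2 * n)) ℂ} (hS' : S' ∈ paramSetPair st ε X J) :
    ∃ U : Matrix (Fin n) (Fin n) ℂ, X * (S' * S⁻¹) = U * X := by
  have hP := isUnit_det_mul_inv_mul_mat hW hS hdet
  obtain ⟨A, B, h⟩ := exists_eq_mul_add_mul hW (X * (S' * S⁻¹))
  have h1 : X * (S' * S⁻¹) * (S * st.mat X) = 0 := by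
    rw [← Matrix.mul_assoc, Matrix.mul_assoc X, Matrix.nonsing_inv_mul_cancel_right _ _ hdet,
      hS'.2]
  have h2 : B * (X * J⁻¹ * S * st.mat X) = 0 := by
    rw [h, Matrix.add_mul] at h1
    have h0 : A * X * (S * st.mat X) = 0 := by
      rw [Matrix.mul_assoc, ← Matrix.mul_assoc X, hS.2, Matrix.mul_zero]
    rw [h0, zero_add] at h1
    rw [← h1]
    simp only [Matrix.mul_assoc]
  have hB : B = 0 := by
    rw [← Matrix.mul_nonsing_inv_cancel_right _ B hP, h2, Matrix.zero_mul]
  exact ⟨A, by rw [h, hB, Matrix.zero_mul, add_zero]⟩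

theorem charpoly_eq_sq (hW : IsUnit (stackedMatrix X J).det)
    {M : Matrix (Fin (2 * n)) (Fin (2 * n)) ℂ} {U : Matrix (Fin n) (Fin n) ℂ}
    (h1 : X * M = U * X) (h2 : X * J⁻¹ * M = U * (X * J⁻¹)) :
    M.charpoly = U.charpoly ^ 2 := by
  let e := (finCongr (two_mul n)).trans finSumFinEquiv.symm
  let D := Matrix.reindex e.symm e.symm (Matrix.fromBlocks U 0 0 U)
  have h : stackedMatrix X J * M = D * stackedMatrix X J := by
    have h3 : Matrix.fromRows X (-(X * J⁻¹)) * M =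
        Matrix.fromBlocks U 0 0 U * Matrix.fromRows X (-(X * J⁻¹)) := by
      rw [Matrix.fromRows_mul, Matrix.fromBlocks_mul_fromRows]
      simp [h1, h2]
    have h4 : stackedMatrix X J * M = (Matrix.fromRows X (-(X * J⁻¹)) * M).submatrix e id := rfl
    rw [h4, h3, ← Matrix.submatrix_mul_equiv _ _ _ e]
    rfl
  have hD : M.charpoly = D.charpoly := by
    have hM : M = (stackedMatrix X J)⁻¹ * D * stackedMatrix X J := by
      rw [Matrix.mul_assoc, ← h, Matrix.nonsing_inv_mul_cancel_left _ _ hW]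
    rw [hM]
    exact Matrix.charpoly_units_conj' (Matrix.nonsingInvUnit _ hW) D
  rw [hD, Matrix.charpoly_reindex, Matrix.charpoly_fromBlocks_zero₁₂, pow_two]

theorem mul_moment_eq {M T : Matrix (Fin (2 * n)) (Fin (2 * n)) ℂ} {U : Matrix (Fin n) (Fin n) ℂ}
    (h1 : X * M = U * X) (hT : Commute T M) (hMS : M * S = S * st.mat M) :
    U * (X * T * S * st.mat X) = X * T * S * st.mat X * st.mat U := by
  have h3 : st.mat X * st.mat U = st.mat M * st.mat X := by
    rw [← st.mat_mul, ← h1, st.mat_mul]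
  calc U * (X * T * S * st.mat X) = U * X * T * S * st.mat X := by
        simp only [Matrix.mul_assoc]
    _ = X * (T * M) * S * st.mat X := by rw [← h1, Matrix.mul_assoc X, hT.eq]
    _ = X * T * (M * S) * st.mat X := by simp only [Matrix.mul_assoc]
    _ = X * T * S * (st.mat X * st.mat U) := by rw [hMS, h3]; simp only [Matrix.mul_assoc]
    _ = _ := by simp only [Matrix.mul_assoc]

end Pair

/-! ### Blocks of a palindromic system -/

theorem mul_eq_mat_mul_quadPoly {m : ℕ} (st : StarKind) (ε : ℂ)
    {A₁ A₀ U : Matrix (Fin m) (Fin m) ℂ} (h1 : A₁ * U = st.mat U * A₁)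
    (h0 : A₀ * U = st.mat U * A₀) (z : ℂ) :
    quadPoly st ε A₁ A₀ z * U = st.mat U * quadPoly st ε A₁ A₀ z := by
  have h2 : st.mat A₁ * U = st.mat U * st.mat A₁ := by
    have := congrArg st.mat h1
    rw [st.mat_mul, st.mat_mul, st.mat_mat] at this
    exact this.symm
  simp only [quadPoly, Matrix.add_mul, Matrix.mul_add, Matrix.smul_mul, Matrix.mul_smul, h0, h1,
    h2]

theorem mat_mul_quadPoly_mul {m : ℕ} (st : StarKind) (ε : ℂ) (K A₁ A₀ : Matrix (Fin m) (Fin m) ℂ)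
    (z : ℂ) : st.mat K * quadPoly st ε A₁ A₀ z * K =
      quadPoly st ε (st.mat K * A₁ * K) (st.mat K * A₀ * K) z := by
  simp only [quadPoly, Matrix.add_mul, Matrix.mul_add, Matrix.smul_mul, Matrix.mul_smul,
    st.mat_mul, st.mat_mat, Matrix.mul_assoc]

theorem mat_diagPart {t N : ℕ} (st : StarKind) (s : Fin t → ℕ) (h : ∑ i, s i = N)
    (M : Matrix (Fin N) (Fin N) ℂ) (i : Fin t) :
    st.mat (diagPart s h M i) = diagPart s h (st.mat M) i := by
  cases st <;> rfl

theorem diagPart_quadPoly {t N : ℕ} (st : StarKind) (ε : ℂ) (s : Fin t → ℕ) (h : ∑ i, s i = N)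
    (A₁ A₀ : Matrix (Fin N) (Fin N) ℂ) (z : ℂ) (i : Fin t) :
    diagPart s h (quadPoly st ε A₁ A₀ z) i =
      quadPoly st ε (diagPart s h A₁ i) (diagPart s h A₀ i) z := by
  rw [quadPoly, quadPoly, mat_diagPart]
  rfl

theorem IsRegularPalindromic.congr {m : ℕ} {st : StarKind} {ε : ℂ}
    {A₁ A₀ K : Matrix (Fin m) (Fin m) ℂ} (h : IsRegularPalindromic st ε A₁ A₀)
    (hK : IsUnit K.det) :
    IsRegularPalindromic st ε (st.mat K * A₁ * K) (st.mat K * A₀ * K) := by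
  refine ⟨?_, ?_⟩
  · rw [Matrix.det_mul, Matrix.det_mul]
    exact ((st.isUnit_det_mat hK).mul h.1).mul hK
  · rw [st.mat_mul, st.mat_mul, st.mat_mat, h.2, Matrix.smul_mul, Matrix.mul_smul,
      Matrix.mul_assoc]

theorem IsRegularPalindromic.diagPart {t N : ℕ} {st : StarKind} {ε : ℂ} {s : Fin t → ℕ}
    {h : ∑ i, s i = N} {A₁ A₀ : Matrix (Fin N) (Fin N) ℂ} (hA : IsRegularPalindromic st ε A₁ A₀)
    (hA₁ : A₁ = diagBlocks s h (diagPart s h A₁)) (i : Fin t) :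
    IsRegularPalindromic st ε (Palindromic.diagPart s h A₁ i)
      (Palindromic.diagPart s h A₀ i) := by
  refine ⟨?_, ?_⟩
  · have := hA.1
    rw [hA₁, det_diagBlocks] at this
    exact isUnit_of_dvd_unit (Finset.dvd_prod_of_mem
      (fun i => (Palindromic.diagPart s h A₁ i).det) (Finset.mem_univ i)) this
  · rw [mat_diagPart, hA.2]
    rfl

end Palindromic

/-! ### Simultaneous block diagonalization -/

theorem theorem3p2 (n : ℕ) (st : Palindromic.StarKind) (ε : ℂ) (hε : ε = 1 ∨ ε = -1)
    (X : Matrix (Fin n) (Fin (2 * n)) ℂ) (J : Matrix (Fin (2 * n)) (Fin (2 * n)) ℂ)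
    (hW : IsUnit (Palindromic.stackedMatrix X J).det)
    (hJ : Palindromic.IsPJCF st J) (hgeom : Palindromic.GeomMultOne J)
    (S S' : Matrix (Fin (2 * n)) (Fin (2 * n)) ℂ)
    (hS : S ∈ Palindromic.paramSetPair st ε X J) (hSdet : IsUnit S.det)
    (hS' : S' ∈ Palindromic.paramSetPair st ε X J) (hSdet' : IsUnit S'.det)
    (t : ℕ) (ns : Fin t → ℕ)
    (hns : Palindromic.zeta st (S' * S⁻¹) = Finset.univ.val.map ns) :
    ∃ (hsum : ∑ i, ns i = n) (K : Matrix (Fin n) (Fin n) ℂ), IsUnit K.det ∧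
      ∀ Shat ∈ Palindromic.paramSetPair st ε X J, IsUnit Shat.det →
        Palindromic.IsRegularPalindromic st ε
          (Palindromic.coeffOne st ε X J Shat) (Palindromic.coeffZero st ε X J Shat) ∧
        ∃ B₁ B₀ : (i : Fin t) → Matrix (Fin (ns i)) (Fin (ns i)) ℂ,
          (∀ i, Palindromic.IsRegularPalindromic st ε (B₁ i) (B₀ i)) ∧
          ∀ z : ℂ,
            st.mat K * Palindromic.quadPoly st ε (Palindromic.coeffOne st ε X J Shat)
                (Palindromic.coeffZero st ε X J Shat) z * K =
              Palindromic.diagBlocks ns hsum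
                fun i => Palindromic.quadPoly st ε (B₁ i) (B₀ i) z := by
  open Palindromic in
  have hJu := isUnit_det_of_mem_paramSet hS.1 hSdet
  have hJM := commute_mul_inv hJu hS.1 hSdet hS'.1
  have hJinvM : Commute J⁻¹ (S' * S⁻¹) := by
    exact Commute.units_inv_left (u := Matrix.nonsingInvUnit J hJu) hJM
  obtain ⟨U, hU⟩ := exists_mul_eq_mul hW hS hSdet hS'
  have hchar : (S' * S⁻¹).charpoly = U.charpoly ^ 2 :=
    charpoly_eq_sq hW hU
      (by rw [Matrix.mul_assoc X, hJinvM.eq, ← Matrix.mul_assoc X, hU, Matrix.mul_assoc U])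
  obtain ⟨c, hdisj, hstar, hcov, hcard⟩ := exists_classes_of_zeta_eq st _ ns hns
  have hUne : U.charpoly ≠ 0 := U.charpoly_monic.ne_zero
  have hmult : ∀ μ, (S' * S⁻¹).charpoly.rootMultiplicity μ =
      2 * U.charpoly.rootMultiplicity μ := by
    intro μ
    rw [hchar, ← Polynomial.count_roots, Polynomial.roots_pow, Multiset.count_nsmul,
      Polynomial.count_roots]
  obtain ⟨hsum, K, hK, hdiag⟩ := exists_congruence_eq_diagBlocks st U c hdisj hstar
    (fun μ hμ => hcov μ (by
      rw [hchar, Polynomial.roots_pow]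
      exact Multiset.mem_nsmul.2 ⟨two_ne_zero, hμ⟩)) ns
    (fun i => by
      rw [hcard i, Finset.sum_congr rfl fun μ _ => hmult μ, ← Finset.mul_sum]
      exact Nat.mul_div_cancel_left _ two_pos)
  refine ⟨hsum, K, hK, fun Shat hShat hShatdet => ?_⟩
  have hreg := isRegularPalindromic_coeff hε hW hShat hShatdet
  have hP := isUnit_det_mul_inv_mul_mat hW hShat hShatdet
  -- `Shat S⁻¹` and `S' S⁻¹` commute, as both commute with the nonderogatory matrix `J`
  have hMS : S' * S⁻¹ * Shat = Shat * st.mat (S' * S⁻¹) := by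
    have hcomm := commute_of_commute_of_geomMultOne hgeom hJM
      (commute_mul_inv hJu hS.1 hSdet hShat.1)
    have hShat_eq : Shat * S⁻¹ * S = Shat := Matrix.nonsing_inv_mul_cancel_right _ _ hSdet
    calc S' * S⁻¹ * Shat = S' * S⁻¹ * (Shat * S⁻¹) * S := by rw [Matrix.mul_assoc _ _ S, hShat_eq]
      _ = Shat * S⁻¹ * (S' * S⁻¹ * S) := by rw [hcomm.eq, Matrix.mul_assoc _ _ S]
      _ = Shat * S⁻¹ * (S * st.mat (S' * S⁻¹)) := by
        rw [Matrix.nonsing_inv_mul_cancel_right _ _ hSdet, mul_mat_mul_inv hε hS.1 hSdet hS'.1]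
      _ = Shat * st.mat (S' * S⁻¹) := by rw [← Matrix.mul_assoc, hShat_eq]
  have hU1 := mul_moment_eq hU hJinvM hMS
  have hU2 := mul_moment_eq hU (hJinvM.pow_left 2) hMS
  have hPU : (X * J⁻¹ * Shat * st.mat X)⁻¹ * U = st.mat U * (X * J⁻¹ * Shat * st.mat X)⁻¹ := by
    conv_lhs => rw [← Matrix.mul_nonsing_inv_cancel_right _ U hP, hU1]
    rw [Matrix.mul_assoc _ (st.mat U), Matrix.nonsing_inv_mul_cancel_left _ _ hP]
  have hA₁ : coeffOne st ε X J Shat * U = st.mat U * coeffOne st ε X J Shat := by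
    rw [coeffOne, Matrix.smul_mul, hPU, Matrix.mul_smul]
  have hA₀ : coeffZero st ε X J Shat * U = st.mat U * coeffZero st ε X J Shat := by
    rw [coeffZero_eq hε, Matrix.neg_mul, Matrix.mul_neg, Matrix.mul_assoc, hPU,
      ← Matrix.mul_assoc, Matrix.mul_assoc _ _ (st.mat U), ← hU2]
    rw [← Matrix.mul_assoc, hPU]
    simp only [Matrix.mul_assoc]
  refine ⟨hreg, _, _, (hreg.congr hK).diagPart (hdiag _ hA₁), fun z => ?_⟩
  rw [hdiag _ (mul_eq_mat_mul_quadPoly st ε hA₁ hA₀ z), mat_mul_quadPoly_mul]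
  exact congrArg _ (funext fun i => diagPart_quadPoly st ε ns hsum _ _ z i)
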